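/- Let $(X,d)$ be a compact metric space. Let $\mathcal{M}(X)$ be the space of all finite signed Borel measures on $X$ and $\mathcal{M}_0(X)$ its subspace of measures of total mass $0$. For $\mu,\nu\in\mathcal{M}(X)$ put $$I(\mu,\nu)=\int_X\int_X d(x,y)\,d\mu(x)\,d\nu(y),\qquad M(X)=\sup\{I(\mu,\mu):\mu\in\mathcal{M}(X),\ \mu(X)=1\}.$$ Assume that $X$ is quasihypermetric, that is, $\sum_{i,j=1}^n\alpha_i\alpha_j d(x_i,x_j)\le 0$ for all $n\in\mathbb{N}$, all $x_1,\dots,x_n\in X$ and all $\alpha_1,\dots,\alpha_n\in\mathbb{R}$ with $\sum_{i=1}^n\alpha_i=0$, so that $(\mu\mid\nu)=-I(\mu,\nu)$ is a semi-inner product on $\mathcal{M}_0(X)$; let $E_0(X)$ denote $\mathcal{M}_0(X)$ with this semi-inner product and the associated seminorm $\|\mu\|=(-I(\mu,\mu))^{1/2}$. If $M(X)<\infty$, then the semi-inner product space $E_0(X)$ is complete if and only if $X$ is finite. -/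

import Mathlib

open MeasureTheory

noncomputable section

namespace DistGeom

/-- A metric space is quasihypermetric if `∑ i j, α i * α j * d (x i) (x j) ≤ 0` for all finite
families of points `x i` and of real weights `α i` with `∑ i, α i = 0`. -/
def IsQuasihypermetric (X : Type*) [MetricSpace X] : Prop :=
  ∀ (n : ℕ) (α : Fin n → ℝ) (x : Fin n → X), ∑ i, α i = 0 →
    ∑ i, ∑ j, α i * α j * dist (x i) (x j) ≤ 0

section Energy

variable {X : Type*} [MetricSpace X] [MeasurableSpace X]

/-- `I(μ, ν) = ∫∫ d(x, y) dμ(x) dν(y)`. -/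
def energy (μ ν : SignedMeasure X) : ℝ :=
  ∫ᵛ y, (∫ᵛ x, dist x y ∂•μ) ∂•ν

variable (X) in
/-- `M(X) = sup {I(μ, μ) : μ a finite signed Borel measure of total mass 1}`, as an extended real
number. -/
def maxEnergy : EReal :=
  ⨆ (μ : SignedMeasure X) (_ : μ Set.univ = 1), ((energy μ μ : ℝ) : EReal)

variable (X) in
/-- The space `M₀(X)` of finite signed Borel measures of total mass `0`. -/
def massZero : Submodule ℝ (SignedMeasure X) where
  carrier := {μ | μ Set.univ = 0}
  zero_mem' := by simp
  add_mem' := by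
    intro μ ν hμ hν
    simp only [Set.mem_ofPred_eq] at *
    simp [hμ, hν]
  smul_mem' := by
    intro c μ hμ
    simp only [Set.mem_ofPred_eq] at *
    simp [hμ]

end Energy

section Facts

variable {X : Type*} [MetricSpace X] [MeasurableSpace X]

lemma isFiniteMeasure_variation (μ : SignedMeasure X) : IsFiniteMeasure μ.variation := by
  rw [← SignedMeasure.totalVariation_eq_variation]
  infer_instance

variable [CompactSpace X] [BorelSpace X]

lemma integrable_of_continuous (μ : SignedMeasure X) {f : X → ℝ} (hf : Continuous f) :
    μ.Integrable f := by
  have := isFiniteMeasure_variation μ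
  obtain ⟨C, hC⟩ := isCompact_univ.exists_bound_of_continuousOn hf.continuousOn
  exact Integrable.of_bound hf.aestronglyMeasurable C
    (Filter.Eventually.of_forall fun x => hC x (Set.mem_univ x))

lemma dist_le_diam (x y : X) : dist x y ≤ Metric.diam (Set.univ : Set X) :=
  Metric.dist_le_diam_of_mem isCompact_univ.isBounded (Set.mem_univ x) (Set.mem_univ y)

lemma continuous_inner (μ : SignedMeasure X) : Continuous fun y => ∫ᵛ x, dist x y ∂•μ := by
  have := isFiniteMeasure_variation μ
  refine VectorMeasure.continuous_of_dominated
    (bound := fun _ => Metric.diam (Set.univ : Set X)) ?_ ?_ ?_ ?_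
  · intro y
    exact (by fun_prop : Continuous fun x : X => dist x y).aestronglyMeasurable
  · intro y
    refine Filter.Eventually.of_forall fun x => ?_
    rw [Real.norm_of_nonneg dist_nonneg]
    exact dist_le_diam x y
  · exact integrable_const _
  · refine Filter.Eventually.of_forall fun x => ?_
    fun_prop

lemma energy_add_left (μ₁ μ₂ ν : SignedMeasure X) :
    energy (μ₁ + μ₂) ν = energy μ₁ ν + energy μ₂ ν := by
  unfold energy
  rw [← VectorMeasure.integral_fun_add (integrable_of_continuous ν (continuous_inner μ₁))
    (integrable_of_continuous ν (continuous_inner μ₂))]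
  congr 1
  ext y
  exact VectorMeasure.integral_add_vectorMeasure
    (integrable_of_continuous μ₁ (by fun_prop)) (integrable_of_continuous μ₂ (by fun_prop))

lemma energy_smul_left (c : ℝ) (μ ν : SignedMeasure X) :
    energy (c • μ) ν = c * energy μ ν := by
  unfold energy
  rw [← smul_eq_mul, ← VectorMeasure.integral_fun_smul]
  congr 1
  ext y
  exact VectorMeasure.integral_smul_vectorMeasure _ _

/-- Integral of a function of a simple function. -/
lemma integral_comp_simpleFunc (μ : SignedMeasure X) (s : SimpleFunc X X) (f : X → ℝ) :
    ∫ᵛ x, f (s x) ∂•μ = ∑ a ∈ s.range, f a * μ (s ⁻¹' {a}) := by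
  classical
  have := isFiniteMeasure_variation μ
  have h : ∀ x, f (s x) = ∑ a ∈ s.range, (s ⁻¹' {a}).indicator (fun _ => f a) x := by
    intro x
    rw [Finset.sum_eq_single (s x)]
    · simp
    · intro b _ hb
      simp [Set.indicator, Ne.symm hb]
    · intro hx
      exact absurd (s.mem_range_self x) hx
  simp_rw [h]
  rw [VectorMeasure.integral_finsetSum]
  · refine Finset.sum_congr rfl fun a _ => ?_
    rw [VectorMeasure.integral_indicator_const]
    · simp
    · exact s.measurableSet_preimage _
  · intro a _
    exact (integrable_const _).indicator (s.measurableSet_preimage _)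

/-- The energy is a limit of discrete energies. -/
lemma exists_tendsto_energy : ∃ s : ℕ → SimpleFunc X X, ∀ μ ν : SignedMeasure X,
    Filter.Tendsto (fun n => ∑ b ∈ (s n).range, ∑ a ∈ (s n).range,
      μ (s n ⁻¹' {a}) * ν (s n ⁻¹' {b}) * dist a b) Filter.atTop (nhds (energy μ ν)) := by
  rcases isEmpty_or_nonempty X with hX | ⟨⟨x₀⟩⟩
  · refine ⟨fun _ => ⟨id, fun x => isEmptyElim x, Set.toFinite _⟩, fun μ ν => ?_⟩
    have h1 : μ = 0 := by
      ext i _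
      simp [Set.eq_empty_of_isEmpty i]
    have h2 : energy μ ν = 0 := by
      subst h1
      simp [energy]
    rw [h2, h1]
    simp
  let s : ℕ → SimpleFunc X X :=
    fun n => SimpleFunc.approxOn (fun x : X => x) measurable_id Set.univ x₀ (Set.mem_univ _) n
  have hs : ∀ x, Filter.Tendsto (fun n => s n x) Filter.atTop (nhds x) := fun x =>
    SimpleFunc.tendsto_approxOn measurable_id (Set.mem_univ _) (by simp)
  refine ⟨s, fun μ ν => ?_⟩
  have := isFiniteMeasure_variation μ
  have := isFiniteMeasure_variation ν
  have key : ∀ n, ∑ b ∈ (s n).range, ∑ a ∈ (s n).range,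
      μ (s n ⁻¹' {a}) * ν (s n ⁻¹' {b}) * dist a b
      = ∫ᵛ y, (∫ᵛ x, dist (s n x) (s n y) ∂•μ) ∂•ν := by
    intro n
    rw [integral_comp_simpleFunc ν (s n) (fun b => ∫ᵛ x, dist (s n x) b ∂•μ)]
    refine Finset.sum_congr rfl fun b _ => ?_
    rw [integral_comp_simpleFunc μ (s n) (fun a => dist a b), Finset.sum_mul]
    refine Finset.sum_congr rfl fun a _ => ?_
    ring
  simp_rw [key]
  unfold energy
  refine VectorMeasure.tendsto_integral_filter_of_dominated_convergence
    (bound := fun _ => Metric.diam (Set.univ : Set X) *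
      ‖ContinuousLinearMap.lsmul ℝ ℝ (E := ℝ)‖ * μ.variation.real Set.univ) ?_ ?_ ?_ ?_
  · refine Filter.Eventually.of_forall fun n => ?_
    exact (((s n).map fun b => ∫ᵛ x, dist (s n x) b ∂•μ).stronglyMeasurable).aestronglyMeasurable
  · refine Filter.Eventually.of_forall fun n => Filter.Eventually.of_forall fun y => ?_
    refine VectorMeasure.norm_integral_le_of_norm_le_const (Filter.Eventually.of_forall fun x => ?_)
    rw [Real.norm_of_nonneg dist_nonneg]
    exact dist_le_diam _ _
  · exact integrable_const _
  · refine Filter.Eventually.of_forall fun y => ?_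
    refine VectorMeasure.tendsto_integral_filter_of_dominated_convergence
      (bound := fun _ => Metric.diam (Set.univ : Set X)) ?_ ?_ ?_ ?_
    · refine Filter.Eventually.of_forall fun n => ?_
      exact ((s n).map fun a => dist a (s n y)).stronglyMeasurable.aestronglyMeasurable
    · refine Filter.Eventually.of_forall fun n => Filter.Eventually.of_forall fun x => ?_
      rw [Real.norm_of_nonneg dist_nonneg]
      exact dist_le_diam _ _
    · exact integrable_const _
    · exact Filter.Eventually.of_forall fun x => (hs x).dist (hs y)

lemma energy_comm (μ ν : SignedMeasure X) : energy μ ν = energy ν μ := by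
  obtain ⟨s, hs⟩ := exists_tendsto_energy (X := X)
  refine tendsto_nhds_unique (hs μ ν) ((hs ν μ).congr fun n => ?_)
  rw [Finset.sum_comm]
  refine Finset.sum_congr rfl fun a _ => Finset.sum_congr rfl fun b _ => ?_
  rw [dist_comm]
  ring

lemma energy_self_nonpos (hX : IsQuasihypermetric X) (μ : SignedMeasure X)
    (hμ : μ Set.univ = 0) : energy μ μ ≤ 0 := by
  obtain ⟨s, hs⟩ := exists_tendsto_energy (X := X)
  refine le_of_tendsto' (hs μ μ) fun n => ?_
  have hsum : ∑ a ∈ (s n).range, μ (s n ⁻¹' {a}) = 0 := by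
    have h := integral_comp_simpleFunc μ (s n) (fun _ => 1)
    have := isFiniteMeasure_variation μ
    simp only [one_mul] at h
    rw [← h, VectorMeasure.integral_const]
    simp [hμ]
  let e := (s n).range.equivFin
  have h := hX _ (fun i => μ (s n ⁻¹' {(e.symm i : X)})) (fun i => (e.symm i : X)) (by
    rw [e.symm.sum_comp (fun a : (s n).range => μ (s n ⁻¹' {(a : X)})),
      Finset.sum_coe_sort (s n).range (fun a => μ (s n ⁻¹' {a}))]
    exact hsum)
  refine le_of_eq_of_le ?_ h
  rw [e.symm.sum_comp (fun b : (s n).range => ∑ j, μ (s n ⁻¹' {(b : X)}) *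
    μ (s n ⁻¹' {(e.symm j : X)}) * dist (b : X) (e.symm j : X)),
    Finset.sum_coe_sort (s n).range (fun b => ∑ j, μ (s n ⁻¹' {b}) *
    μ (s n ⁻¹' {(e.symm j : X)}) * dist b (e.symm j : X))]
  refine Finset.sum_congr rfl fun b _ => ?_
  rw [e.symm.sum_comp (fun a : (s n).range => μ (s n ⁻¹' {b}) *
    μ (s n ⁻¹' {(a : X)}) * dist b (a : X)),
    Finset.sum_coe_sort (s n).range (fun a => μ (s n ⁻¹' {b}) *
    μ (s n ⁻¹' {a}) * dist b a)]
  refine Finset.sum_congr rfl fun a _ => ?_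
  rw [dist_comm]
  ring

end Facts

section SemiInner

/-- The underlying vector space of `E₀(X)` is the space of finite signed Borel measures of total
mass `0`. -/
def E₀ (X : Type*) [MetricSpace X] [MeasurableSpace X] (_hX : IsQuasihypermetric X) : Type _ :=
  massZero X

variable {X : Type*} [MetricSpace X] [MeasurableSpace X] (hX : IsQuasihypermetric X)

/-- The signed measure underlying an element of `E₀(X)`. -/
def E₀.toMeasure {hX : IsQuasihypermetric X} (μ : E₀ X hX) : SignedMeasure X :=
  Subtype.val (p := fun ν => ν ∈ massZero X) μ

instance E₀.instAddCommGroup : AddCommGroup (E₀ X hX) :=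
  inferInstanceAs (AddCommGroup (massZero X))

instance E₀.instModule : Module ℝ (E₀ X hX) :=
  inferInstanceAs (Module ℝ (massZero X))

variable [CompactSpace X] [BorelSpace X]

/-- The semi-inner product `(μ | ν) = -I(μ, ν)` on the measures of total mass `0`. -/
@[reducible]
def E₀.core : PreInnerProductSpace.Core ℝ (E₀ X hX) where
  inner μ ν := -energy μ.toMeasure ν.toMeasure
  conj_inner_symm μ ν := by
    rw [energy_comm ν.toMeasure μ.toMeasure]
    rfl
  re_inner_nonneg μ := by
    have h := energy_self_nonpos hX μ.toMeasure μ.2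
    simpa using h
  add_left μ₁ μ₂ ν := by
    have h := energy_add_left μ₁.toMeasure μ₂.toMeasure ν.toMeasure
    change -energy (μ₁.toMeasure + μ₂.toMeasure) ν.toMeasure = _
    rw [h]
    ring
  smul_left μ ν c := by
    have h := energy_smul_left c μ.toMeasure ν.toMeasure
    change -energy (c • μ.toMeasure) ν.toMeasure = _
    rw [h]
    simp

/-- The seminorm `‖μ‖ = (-I(μ, μ)) ^ (1/2)` on `E₀(X)`, with its topology and uniformity. -/
instance E₀.instSeminormedAddCommGroup : SeminormedAddCommGroup (E₀ X hX) :=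
  @InnerProductSpace.Core.toSeminormedAddCommGroup ℝ (E₀ X hX) _ _ _ (E₀.core hX)

instance E₀.instInnerProductSpace : InnerProductSpace ℝ (E₀ X hX) :=
  InnerProductSpace.ofCore (E₀.core hX)

lemma E₀.inner_eq (μ ν : E₀ X hX) : inner ℝ μ ν = -energy μ.toMeasure ν.toMeasure := rfl

lemma E₀.norm_eq (μ : E₀ X hX) : ‖μ‖ = Real.sqrt (-energy μ.toMeasure μ.toMeasure) := rfl

end SemiInner

end DistGeom

end

/-! The vectors `(δ_x - δ_y) / d(x, y)` have norm `√(2 / d(x, y))`. They are weakly bounded, since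
`(δ_x - δ_y | μ) = -∫ (d(x, z) - d(y, z)) dμ(z)` is at most `d(x, y) |μ|(X)` in absolute value. If
`E₀(X)` is complete, the uniform boundedness principle makes them norm bounded, so distinct points
of `X` stay a fixed distance apart, and compactness forces `X` to be finite. Conversely, if `X` is
finite then `E₀(X)` is finite-dimensional, hence complete. -/

noncomputable section

namespace DistGeom

lemma moduleFinite_vectorMeasure (R Y M : Type*) [Ring R] [AddCommGroup M] [TopologicalSpace M]
    [ContinuousAdd M] [Module R M] [ContinuousConstSMul R M] [IsNoetherian R M]
    [MeasurableSpace Y] [Finite Y] : Module.Finite R (VectorMeasure Y M) :=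
  let evalₗ : VectorMeasure Y M →ₗ[R] Set Y → M :=
    { toFun := fun μ s => μ s
      map_add' := fun _ _ => rfl
      map_smul' := fun _ _ => rfl }
  Module.Finite.of_injective evalₗ DFunLike.coe_injective

lemma completeSpace_of_finiteDimensional (𝕜 E : Type*) [NontriviallyNormedField 𝕜]
    [CompleteSpace 𝕜] [AddCommGroup E] [UniformSpace E] [IsUniformAddGroup E] [Module 𝕜 E]
    [ContinuousSMul 𝕜 E] [FiniteDimensional 𝕜 E] : CompleteSpace E :=
  SeparationQuotient.completeSpace_iff.1 (FiniteDimensional.complete 𝕜 (SeparationQuotient E))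

lemma E₀.finiteDimensional {X : Type*} [MetricSpace X] [MeasurableSpace X] [Finite X]
    (hX : IsQuasihypermetric X) : FiniteDimensional ℝ (E₀ X hX) :=
  have := moduleFinite_vectorMeasure ℝ X ℝ
  inferInstanceAs (FiniteDimensional ℝ (massZero X))

lemma exists_norm_le_of_weakly_bounded {𝕜 E ι : Type*} [RCLike 𝕜] [SeminormedAddCommGroup E]
    [InnerProductSpace 𝕜 E] [CompleteSpace E] {v : ι → E}
    (hv : ∀ w, ∃ C, ∀ i, ‖inner 𝕜 (v i) w‖ ≤ C) : ∃ C, ∀ i, ‖v i‖ ≤ C := by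
  simpa only [innerSL_apply_norm] using banach_steinhaus (g := fun i => innerSL 𝕜 (v i)) hv

lemma abs_integral_le_of_forall_abs_le {Y : Type*} [MeasurableSpace Y] (μ : SignedMeasure Y)
    {f : Y → ℝ} {C : ℝ} (hf : ∀ y, |f y| ≤ C) :
    |∫ᵛ y, f y ∂•μ| ≤ C * μ.variation.real Set.univ := by
  have : IsFiniteMeasure μ.variation := by
    rw [← SignedMeasure.totalVariation_eq_variation]
    infer_instance
  simpa using VectorMeasure.norm_integral_le_of_norm_le_const (μ := μ)
    (B := ContinuousLinearMap.lsmul ℝ ℝ) (Filter.Eventually.of_forall hf)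

variable {X : Type*} [MetricSpace X] [MeasurableSpace X]

/-- The element `δ_x - δ_y` of `E₀(X)`, the difference of two unit point masses. -/
def E₀.diracSub (hX : IsQuasihypermetric X) (x y : X) : E₀ X hX :=
  (⟨VectorMeasure.dirac x 1 - VectorMeasure.dirac y 1, show _ = _ by simp⟩ : massZero X)

/-- The normalised difference `(δ_x - δ_y) / d(x, y)` of two unit point masses, to which the uniform
boundedness principle is applied; it is `0` when `x = y`. -/
def E₀.diracSlope (hX : IsQuasihypermetric X) (x y : X) : E₀ X hX :=
  (dist x y)⁻¹ • E₀.diracSub hX x y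

variable [CompactSpace X] [BorelSpace X] (hX : IsQuasihypermetric X)

lemma integral_diracSub {f : X → ℝ} (hf : Continuous f) (x y : X) :
    ∫ᵛ z, f z ∂•(E₀.diracSub hX x y).toMeasure = f x - f y := by
  change ∫ᵛ z, f z ∂•(VectorMeasure.dirac x 1 - VectorMeasure.dirac y 1 : SignedMeasure X) = _
  simp [VectorMeasure.integral_sub_vectorMeasure (integrable_of_continuous _ hf)
    (integrable_of_continuous _ hf), VectorMeasure.integral_dirac]

lemma inner_diracSub_left (x y : X) (μ : E₀ X hX) :
    inner ℝ (E₀.diracSub hX x y) μ = -∫ᵛ z, (dist x z - dist y z) ∂•μ.toMeasure := by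
  have potential (z : X) :
      ∫ᵛ w, dist w z ∂•(E₀.diracSub hX x y).toMeasure = dist x z - dist y z :=
    integral_diracSub hX (f := fun w => dist w z) (by fun_prop) x y
  simp only [E₀.inner_eq, energy, potential]

lemma norm_diracSub_sq (x y : X) : ‖E₀.diracSub hX x y‖ ^ 2 = 2 * dist x y := by
  rw [← real_inner_self_eq_norm_sq, inner_diracSub_left,
    integral_diracSub hX (f := fun z => dist x z - dist y z) (by fun_prop)]
  simp only [dist_self, dist_comm y x]
  ring

lemma norm_diracSlope_sq (x y : X) : ‖E₀.diracSlope hX x y‖ ^ 2 = 2 / dist x y := by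
  rw [E₀.diracSlope, norm_smul, norm_inv, Real.norm_of_nonneg dist_nonneg, mul_pow,
    norm_diracSub_sq]
  rcases eq_or_ne (dist x y) 0 with h | h
  · simp [h]
  · field_simp

lemma abs_inner_diracSub_le (x y : X) (μ : E₀ X hX) :
    |inner ℝ (E₀.diracSub hX x y) μ| ≤ dist x y * μ.toMeasure.variation.real Set.univ := by
  rw [inner_diracSub_left, abs_neg]
  exact abs_integral_le_of_forall_abs_le _ (abs_dist_sub_le x y)

lemma abs_inner_diracSlope_le (x y : X) (μ : E₀ X hX) :
    |inner ℝ (E₀.diracSlope hX x y) μ| ≤ μ.toMeasure.variation.real Set.univ := by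
  rw [E₀.diracSlope, real_inner_smul_left, abs_mul, abs_of_nonneg (inv_nonneg.2 dist_nonneg)]
  exact inv_mul_le_of_le_mul₀ dist_nonneg measureReal_nonneg (abs_inner_diracSub_le hX x y μ)

lemma exists_pos_pairwise_le_dist [CompleteSpace (E₀ X hX)] :
    ∃ r : ℝ, 0 < r ∧ Pairwise (r ≤ dist · · : X → X → Prop) := by
  obtain ⟨C, hC⟩ : ∃ C, ∀ p : X × X, ‖E₀.diracSlope hX p.1 p.2‖ ≤ C :=
    exists_norm_le_of_weakly_bounded (𝕜 := ℝ) fun μ =>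
      ⟨_, fun p => abs_inner_diracSlope_le hX p.1 p.2 μ⟩
  refine ⟨2 / (C ^ 2 + 1), by positivity, fun x y hxy => ?_⟩
  have hd : 0 < dist x y := dist_pos.2 hxy
  have hslope : 2 / dist x y ≤ C ^ 2 := by
    rw [← norm_diracSlope_sq hX]
    exact pow_le_pow_left₀ (norm_nonneg _) (hC (x, y)) 2
  exact (div_le_comm₀ (by positivity) hd).2 (hslope.trans (le_add_of_nonneg_right zero_le_one))

lemma finite_of_completeSpace [CompleteSpace (E₀ X hX)] : Finite X := by
  obtain ⟨r, hr, hsep⟩ := exists_pos_pairwise_le_dist hX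
  have := DiscreteTopology.of_forall_le_dist hr hsep
  exact finite_of_compact_of_discrete

end DistGeom

end

theorem theorem2p31_general {X : Type*} [MetricSpace X] [CompactSpace X] [MeasurableSpace X]
    [BorelSpace X] (hX : DistGeom.IsQuasihypermetric X) :
    CompleteSpace (DistGeom.E₀ X hX) ↔ Finite X where
  mp _ := DistGeom.finite_of_completeSpace hX
  mpr _ :=
    have := DistGeom.E₀.finiteDimensional hX
    DistGeom.completeSpace_of_finiteDimensional ℝ _

/-- For a compact quasihypermetric space `X` with `M(X) < ∞`, the semi-inner product space `E₀(X)`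
is complete if and only if `X` is finite. -/
theorem theorem2p31 {X : Type*} [MetricSpace X] [CompactSpace X] [MeasurableSpace X] [BorelSpace X]
    (hX : DistGeom.IsQuasihypermetric X) (hM : DistGeom.maxEnergy X < ⊤) :
    CompleteSpace (DistGeom.E₀ X hX) ↔ Finite X :=
  theorem2p31_general hX
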